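/- Let $m\ge n$ and let $e_1,\dots,e_m\in\mathbb R^n$ be unit vectors, any $n$ of which are linearly independent. Let $\Omega=\{\lambda_1e_1+\cdots+\lambda_me_m:\lambda_1,\dots,\lambda_m>0\}$ be the polyhedral cone they span, let $T_\Omega=\mathbb R^n+i\Omega\subset\mathbb C^n$ be the tube domain over $\Omega$, and let $H^1(T_\Omega)$ be the space of holomorphic functions $F$ on $T_\Omega$ with $\sup_{y\in\Omega}\int_{\mathbb R^n}|F(x+iy)|\,dx<\infty$. For $\mathbf t=(t_1,\dots,t_m)\in\mathbb R^m$ write $\pi(\mathbf t)=t_1e_1+\cdots+t_me_m$, and for $\varepsilon>0$ write $\boldsymbol\varepsilon=(\varepsilon,\dots,\varepsilon)\in\mathbb R^m$. Let $P_t(s)=\frac1\pi\frac{t}{t^2+s^2}$ be the Poisson kernel on $\mathbb R$, let $(f*_\mu P_t)(x)=\int_{\mathbb R}f(x-se_\mu)P_t(s)\,ds$, and let $f*P_{\mathbf t}=f*_1P_{t_1}*_2\cdots*_mP_{t_m}$ be the iterated Poisson integral, computed from left to right. Let $F\in H^1(T_\Omega)$, $0<q<\infty$ and $\varepsilon>0$,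 and put $f_\varepsilon(x)=F(x+i\pi(\boldsymbol\varepsilon))$ for $x\in\mathbb R^n$. Then for every $\mathbf t\in(0,\infty)^m$ all the successive integrals that define $|f_\varepsilon|^q*P_{\mathbf t}$ converge absolutely at every point of $\mathbb R^n$, and $$|F(x+i\pi(\mathbf t+\boldsymbol\varepsilon))|^q\le \big(|f_\varepsilon|^q*P_{\mathbf t}\big)(x)\qquad\text{for all }x\in\mathbb R^n .$$ -/

import Mathlib

open MeasureTheory
open scoped ENNReal

namespace TubeHardy

noncomputable section

/-- The projection `π : ℝᵐ → ℝⁿ`, `(t₁, …, tₘ) ↦ t₁ e₁ + ⋯ + tₘ eₘ`. -/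
def proj {n m : ℕ} (e : Fin m → EuclideanSpace ℝ (Fin n)) (t : Fin m → ℝ) :
    EuclideanSpace ℝ (Fin n) :=
  ∑ j, t j • e j

/-- The open polyhedral cone `Ω = {λ₁ e₁ + ⋯ + λₘ eₘ ; λ₁, …, λₘ > 0}`. -/
def cone {n m : ℕ} (e : Fin m → EuclideanSpace ℝ (Fin n)) : Set (EuclideanSpace ℝ (Fin n)) :=
  {y | ∃ t : Fin m → ℝ, (∀ j, 0 < t j) ∧ y = proj e t}

/-- The point `x + i y` of `ℂⁿ`, for `x, y ∈ ℝⁿ`. -/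
def cpoint {n : ℕ} (x y : EuclideanSpace ℝ (Fin n)) : EuclideanSpace ℂ (Fin n) :=
  WithLp.toLp 2 fun k => (x k : ℂ) + Complex.I * (y k : ℂ)

/-- The tube domain `T_Ω = ℝⁿ + i Ω` over the polyhedral cone spanned by `e₁, …, eₘ`. -/
def tube {n m : ℕ} (e : Fin m → EuclideanSpace ℝ (Fin n)) : Set (EuclideanSpace ℂ (Fin n)) :=
  {z | ∃ x y, y ∈ cone e ∧ z = cpoint x y}

/-- `‖F‖_{H^p(T_Ω)} = (sup_{y ∈ Ω} ∫ |F(x + i y)|^p dx)^{1/p}`, with values in `[0, ∞]`. -/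
def hardyNorm {n m : ℕ} (e : Fin m → EuclideanSpace ℝ (Fin n)) (p : ℝ)
    (F : EuclideanSpace ℂ (Fin n) → ℂ) : ℝ≥0∞ :=
  (⨆ y ∈ cone e, ∫⁻ x : EuclideanSpace ℝ (Fin n), ‖F (cpoint x y)‖ₑ ^ p) ^ (1 / p)

/-- `F ∈ H^p(T_Ω)`: `F` is holomorphic on `T_Ω` and its `H^p` norm is finite.
(`F` is a total function; only its values on `T_Ω` matter.) -/
def MemHardy {n m : ℕ} (e : Fin m → EuclideanSpace ℝ (Fin n)) (p : ℝ)
    (F : EuclideanSpace ℂ (Fin n) → ℂ) : Prop :=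
  DifferentiableOn ℂ F (tube e) ∧ hardyNorm e p F < ∞

/-- The Poisson kernel `P_t(s) = (1/π) t / (t² + s²)` on `ℝ`. -/
def linePoissonKernel (t s : ℝ) : ℝ :=
  1 / Real.pi * (t / (t ^ 2 + s ^ 2))

/-- Convolution along the line spanned by `v`: `x ↦ ∫ f(x - s v) g(s) ds`. -/
def lineConv {n : ℕ} (v : EuclideanSpace ℝ (Fin n)) (f : EuclideanSpace ℝ (Fin n) → ℝ)
    (g : ℝ → ℝ) (x : EuclideanSpace ℝ (Fin n)) : ℝ :=
  ∫ s : ℝ, f (x - s • v) * g s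

/-- The iterated Poisson integral `f * P_t = f *₁ P_{t₁} *₂ P_{t₂} ⋯ *ₘ P_{tₘ}`, the convolutions
being performed successively from left to right. -/
def iteratedPoisson {n : ℕ} (f : EuclideanSpace ℝ (Fin n) → ℝ) :
    (m : ℕ) → (Fin m → EuclideanSpace ℝ (Fin n)) → (Fin m → ℝ) → EuclideanSpace ℝ (Fin n) → ℝ
  | 0, _, _ => f
  | m + 1, e, t =>
      lineConv (e (Fin.last m))
        (iteratedPoisson f m (fun j => e j.castSucc) (fun j => t j.castSucc))
        (linePoissonKernel (t (Fin.last m)))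

/-- All the integrals over `ℝ` that occur in the iterated Poisson integral
`f *₁ P_{t₁} *₂ P_{t₂} ⋯ *ₘ P_{tₘ}` converge absolutely, at every point of `ℝⁿ`. -/
def IteratedPoissonConverges {n : ℕ} (f : EuclideanSpace ℝ (Fin n) → ℝ) :
    (m : ℕ) → (Fin m → EuclideanSpace ℝ (Fin n)) → (Fin m → ℝ) → Prop
  | 0, _, _ => True
  | m + 1, e, t =>
      IteratedPoissonConverges f m (fun j => e j.castSucc) (fun j => t j.castSucc) ∧
      ∀ x : EuclideanSpace ℝ (Fin n), Integrable fun s : ℝ =>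
        iteratedPoisson f m (fun j => e j.castSucc) (fun j => t j.castSucc)
          (x - s • e (Fin.last m)) * linePoissonKernel (t (Fin.last m)) s

end

end TubeHardy

namespace TubeHardy

open Real Set Filter Topology Metric

/-! Restricted to a complex line, `z ↦ F (x + iy + z e_j)` is holomorphic near the closed upper
half-plane. If it is bounded there, its `q`-th power modulus is majorized by the Poisson integral of
its boundary values (`norm_rpow_le_integral_linePoissonKernel`). Treating the directions one at a
time gives the theorem (`norm_rpow_le_iteratedPoisson`): adding nonnegative multiples of `e_j` never
leaves the cone, and the kernels are positive.

The half-plane estimate comes from Jensen's formula, which yields a sub-mean value property of `‖g‖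
^ q` on discs, transported by the Cayley transform. The `H^1` hypothesis serves only to bound `F` on
`y₀ + closed cone` (`MemHardy.exists_bound`), by averaging `‖F‖` over balls of one fixed radius.
Boundedness also makes all the integrals converge. -/

/-! ### Sub-mean value property on discs. -/

/-- This is `x + 1 ≤ exp x` at `x = q log y - 1`, with equality at `y = exp (1 / q)`. -/
lemma exp_one_mul_log_le_rpow {q y : ℝ} (hq : 0 < q) (hy : 0 ≤ y) :
    exp 1 * q * log y ≤ y ^ q := by
  rcases hy.eq_or_lt with rfl | hy
  · simp [hq.ne']
  · rw [rpow_def_of_pos hy]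
    have h := add_one_le_exp (log y * q - 1)
    have h2 : exp (log y * q) = exp 1 * exp (log y * q - 1) := by rw [← exp_add]; ring_nf
    rw [h2, mul_assoc]
    exact mul_le_mul_of_nonneg_left (by linarith) (exp_pos 1).le

/-- In Jensen's formula each zero `u` contributes its multiplicity times `log (R / ‖c - u‖) ≥ 0`. -/
lemma log_norm_le_circleAverage_log_norm {g : ℂ → ℂ} {c : ℂ} {R : ℝ} (hR : 0 < R)
    (hg : AnalyticOnNhd ℂ g (closedBall c R)) (h0 : g c ≠ 0) :
    log ‖g c‖ ≤ circleAverage (fun z => log ‖g z‖) c R := by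
  rw [← abs_of_pos hR] at hg
  rw [AnalyticOnNhd.circleAverage_log_norm hR.ne' hg h0]
  refine le_add_of_nonneg_left (finsum_nonneg fun u => ?_)
  by_cases hu : u ∈ closedBall c |R|
  · refine mul_nonneg ?_ ?_
    · exact_mod_cast MeromorphicOn.AnalyticOnNhd.divisor_nonneg hg u
    · rcases eq_or_ne ‖c - u‖ 0 with h | h
      · simp [h]
      · apply log_nonneg
        rw [← div_eq_mul_inv, le_div_iff₀ (lt_of_le_of_ne (norm_nonneg _) h.symm), one_mul]
        rwa [abs_of_pos hR, mem_closedBall, dist_comm, dist_eq_norm] at hu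
  · simp [Function.locallyFinsuppWithin.apply_eq_zero_of_notMem _ hu]

lemma circleIntegrable_norm_rpow {g : ℂ → ℂ} {c : ℂ} {R q : ℝ} (hR : 0 ≤ R) (hq : 0 < q)
    (hg : ContinuousOn g (closedBall c R)) : CircleIntegrable (fun z => ‖g z‖ ^ q) c R :=
  ((hg.mono sphere_subset_closedBall).norm.rpow_const fun _ _ => Or.inr hq.le).circleIntegrable hR

/-- The power `‖g‖ ^ q` of an analytic function has the sub-mean value property. -/
lemma norm_rpow_le_circleAverage {g : ℂ → ℂ} {c : ℂ} {R q : ℝ} (hR : 0 < R) (hq : 0 < q)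
    (hg : AnalyticOnNhd ℂ g (closedBall c R)) :
    ‖g c‖ ^ q ≤ circleAverage (fun z => ‖g z‖ ^ q) c R := by
  by_cases h0 : g c = 0
  · rw [h0, norm_zero, zero_rpow hq.ne']
    exact circleAverage_nonneg_of_nonneg fun _ _ => rpow_nonneg (norm_nonneg _) _
  -- The scaling puts `‖K * g c‖` at `exp (1 / q)`, where `exp_one_mul_log_le_rpow` is an equality,
  -- so nothing is lost at the centre.
  set K : ℂ := (exp (1 / q) : ℂ) / g c with hK
  have hK0 : K ≠ 0 := div_ne_zero (by exact_mod_cast (exp_pos _).ne') h0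
  set u : ℂ → ℂ := fun z => K * g z with hu
  have hua : AnalyticOnNhd ℂ u (closedBall c R) := analyticOnNhd_const.mul hg
  have huc : ‖u c‖ = exp (1 / q) := by
    simp only [hu, hK, div_mul_cancel₀ _ h0]
    rw [Complex.norm_real, norm_of_nonneg (exp_pos _).le]
  have hJ := log_norm_le_circleAverage_log_norm hR hua
    (norm_ne_zero_iff.1 (huc ▸ (exp_pos _).ne'))
  rw [huc, log_exp] at hJ
  have hint : CircleIntegrable (fun z => log ‖u z‖) c R := by
    apply MeromorphicOn.circleIntegrable_log_norm
    rw [abs_of_pos hR]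
    exact (hua.mono sphere_subset_closedBall).meromorphicOn
  have hmono : circleAverage (fun z => (exp 1 * q) • log ‖u z‖) c R
      ≤ circleAverage (fun z => ‖K‖ ^ q • ‖g z‖ ^ q) c R := by
    refine circleAverage_mono (hint.const_smul) ((circleIntegrable_norm_rpow hR.le hq
      hg.continuousOn).const_smul) fun z _ => ?_
    simp only [smul_eq_mul]
    rw [← mul_rpow (norm_nonneg _) (norm_nonneg _), ← norm_mul]
    exact exp_one_mul_log_le_rpow hq (norm_nonneg _)
  rw [circleAverage_fun_smul, circleAverage_fun_smul, smul_eq_mul, smul_eq_mul] at hmono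
  have hKq : ‖K‖ ^ q * ‖g c‖ ^ q = exp 1 := by
    rw [← mul_rpow (norm_nonneg _) (norm_nonneg _), ← norm_mul]
    change ‖u c‖ ^ q = _
    rw [huc, ← exp_mul, one_div_mul_cancel hq.ne']
  have h1 : exp 1 ≤ exp 1 * q * circleAverage (fun z => log ‖u z‖) c R := by
    calc exp 1 = exp 1 * q * (1 / q) := by field_simp
      _ ≤ _ := mul_le_mul_of_nonneg_left hJ (by positivity)
  exact le_of_mul_le_mul_left (hKq.le.trans (h1.trans hmono))
    (rpow_pos_of_pos (norm_pos_iff.2 hK0) _)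

/-! ### Poisson majorization on the upper half-plane. -/

/-- The Cayley transform of the unit disc onto the upper half-plane, with `0 ↦ i τ`. -/
noncomputable def cayley (τ : ℝ) (z : ℂ) : ℂ := Complex.I * τ * ((1 - z) / (1 + z))

lemma im_cayley (τ : ℝ) (z : ℂ) :
    (cayley τ z).im = τ * ((1 - ‖z‖ ^ 2) / ‖1 + z‖ ^ 2) := by
  have h : (cayley τ z).im = τ * ((1 - z) / (1 + z)).re := by
    simp [cayley, mul_assoc]
  rw [h, Complex.div_re, ← Complex.normSq_eq_norm_sq, ← Complex.normSq_eq_norm_sq]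
  simp only [Complex.normSq_apply, Complex.sub_re, Complex.one_re, Complex.add_re, Complex.sub_im,
    Complex.one_im, Complex.add_im]
  ring

/-- At `z = -1` division by zero gives the value `0`, so the closed disc needs no exception. -/
lemma im_cayley_nonneg {τ : ℝ} (hτ : 0 < τ) {z : ℂ} (hz : ‖z‖ ≤ 1) : 0 ≤ (cayley τ z).im := by
  rw [im_cayley]
  have : 0 ≤ 1 - ‖z‖ ^ 2 := by nlinarith [norm_nonneg z]
  positivity

lemma one_add_ne_zero_of_norm_lt {z : ℂ} (hz : ‖z‖ < 1) : 1 + z ≠ 0 := by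
  intro h
  rw [(neg_eq_of_add_eq_zero_right h).symm] at hz
  simp at hz

lemma im_cayley_pos {τ : ℝ} (hτ : 0 < τ) {z : ℂ} (hz : ‖z‖ < 1) : 0 < (cayley τ z).im := by
  rw [im_cayley]
  have : 0 < 1 - ‖z‖ ^ 2 := by nlinarith [norm_nonneg z]
  have : 0 < ‖1 + z‖ := norm_pos_iff.2 (one_add_ne_zero_of_norm_lt hz)
  positivity

lemma differentiableAt_cayley (τ : ℝ) {z : ℂ} (hz : 1 + z ≠ 0) :
    DifferentiableAt ℂ (cayley τ) z := by
  unfold cayley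
  fun_prop (disch := assumption)

lemma one_add_circleMap_ne_zero {θ : ℝ} (hθ : θ ∈ Ioo (-π) π) : 1 + circleMap 0 1 θ ≠ 0 := by
  intro h
  have h1 := congrArg Complex.re h
  simp [circleMap, Complex.exp_ofReal_mul_I_re] at h1
  have h2 : cos (θ / 2) ≠ 0 := (cos_pos_of_mem_Ioo ⟨by linarith [hθ.1], by linarith [hθ.2]⟩).ne'
  have h3 : cos θ = 2 * cos (θ / 2) ^ 2 - 1 := by rw [← cos_two_mul]; ring_nf
  rw [h3] at h1
  exact h2 (by nlinarith)

/-- With `a` the half angle, `(1 - e^{2ia}) / (1 + e^{2ia}) = -i tan a`. -/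
lemma cayley_circleMap_two_arctan {τ : ℝ} (hτ : τ ≠ 0) (s : ℝ) :
    cayley τ (circleMap 0 1 (2 * arctan (s / τ))) = s := by
  have hne : 1 + circleMap 0 1 (2 * arctan (s / τ)) ≠ 0 :=
    one_add_circleMap_ne_zero ⟨by linarith [neg_pi_div_two_lt_arctan (s / τ)],
      by linarith [arctan_lt_pi_div_two (s / τ)]⟩
  set a := arctan (s / τ) with ha
  have hc : cos a ≠ 0 := (cos_arctan_pos _).ne'
  have ht : s * cos a = τ * sin a := by
    have : tan a = s / τ := tan_arctan _
    rw [tan_eq_sin_div_cos] at this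
    field_simp at this
    linarith
  rw [cayley, ← mul_div_assoc, div_eq_iff hne]
  have hm : circleMap 0 1 (2 * a) = ((cos (2 * a) : ℝ) : ℂ) + ((sin (2 * a) : ℝ) : ℂ) * Complex.I := by
    rw [circleMap, Complex.ofReal_cos, Complex.ofReal_sin, ← Complex.exp_mul_I]; simp
  rw [hm]
  have hs2 := sin_sq_add_cos_sq a
  have e1 : τ * sin (2 * a) = s * (1 + cos (2 * a)) := by
    rw [sin_two_mul, cos_two_mul]; linear_combination (-2 * cos a) * ht
  have e2 : τ * (1 - cos (2 * a)) = s * sin (2 * a) := by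
    rw [sin_two_mul, cos_two_mul]; linear_combination (-2 * sin a) * ht - 2 * τ * hs2
  generalize cos (2 * a) = C at e1 e2
  generalize sin (2 * a) = S at e1 e2
  apply Complex.ext
  · simp; linarith
  · simp; linarith

/-- Change of variables `θ = 2 arctan (s / τ)` between the circle and the Poisson kernel. -/
lemma integral_Ioo_eq_integral_linePoissonKernel {τ : ℝ} (hτ : 0 < τ) (h : ℝ → ℝ) :
    (2 * π)⁻¹ * ∫ θ in Ioo (-π) π, h θ
      = ∫ s, h (2 * arctan (s / τ)) * linePoissonKernel τ s := by
  have himg : (fun s : ℝ => 2 * arctan (s / τ)) '' univ = Ioo (-π) π := by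
    ext θ
    simp only [image_univ, mem_range]
    constructor
    · rintro ⟨s, rfl⟩
      exact ⟨by linarith [neg_pi_div_two_lt_arctan (s / τ)],
        by linarith [arctan_lt_pi_div_two (s / τ)]⟩
    · intro hθ
      refine ⟨τ * tan (θ / 2), ?_⟩
      rw [mul_div_cancel_left₀ _ hτ.ne', arctan_tan (by linarith [hθ.1]) (by linarith [hθ.2])]
      ring
  have hder : ∀ s ∈ (univ : Set ℝ), HasDerivWithinAt (fun s : ℝ => 2 * arctan (s / τ))
      (2 * (1 / (1 + (s / τ) ^ 2) * (1 / τ))) univ s := fun s _ =>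
    (((hasDerivAt_id s).div_const τ).arctan.const_mul 2).hasDerivWithinAt
  have hinj : InjOn (fun s : ℝ => 2 * arctan (s / τ)) univ := by
    intro a _ b _ hab
    have : a / τ = b / τ := arctan_injective (by simpa using hab)
    field_simp at this
    exact this
  rw [← himg, integral_image_eq_integral_abs_deriv_smul MeasurableSet.univ hder hinj,
    Measure.restrict_univ, ← integral_const_mul]
  refine integral_congr_ae (Eventually.of_forall fun s => ?_)
  have : 0 < τ ^ 2 + s ^ 2 := by positivity
  simp only [linePoissonKernel, smul_eq_mul]
  rw [abs_of_nonneg (by positivity)]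
  field_simp

/-- The Poisson majorization of `‖H‖ ^ q` for a bounded holomorphic function on the upper
half-plane that is continuous up to the boundary. -/
theorem norm_rpow_le_integral_linePoissonKernel {H : ℂ → ℂ} {M q τ : ℝ} (hq : 0 < q) (hτ : 0 < τ)
    (hd : DifferentiableOn ℂ H {z | 0 < z.im}) (hc : ContinuousOn H {z | 0 ≤ z.im})
    (hM : ∀ z : ℂ, 0 ≤ z.im → ‖H z‖ ≤ M) :
    ‖H (τ * Complex.I)‖ ^ q ≤ ∫ s : ℝ, ‖H s‖ ^ q * linePoissonKernel τ s := by
  set g : ℂ → ℂ := fun z => H (cayley τ z) with hg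
  have hgan : ∀ r < 1, AnalyticOnNhd ℂ g (closedBall 0 r) := by
    intro r hr
    have hdb : DifferentiableOn ℂ g (ball 0 1) := fun z hz => by
      have hz' : ‖z‖ < 1 := by simpa using hz
      have hop : IsOpen {z : ℂ | 0 < z.im} := isOpen_lt continuous_const Complex.continuous_im
      exact ((hd.differentiableAt (hop.mem_nhds (im_cayley_pos hτ hz'))).comp z
        (differentiableAt_cayley τ (one_add_ne_zero_of_norm_lt hz'))).differentiableWithinAt
    exact (hdb.analyticOnNhd isOpen_ball).mono (closedBall_subset_ball hr)
  have hgb : ∀ z : ℂ, ‖z‖ ≤ 1 → ‖g z‖ ≤ M := fun z hz => hM _ (im_cayley_nonneg hτ hz)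
  have hnorm : ∀ r : ℝ, 0 ≤ r → ∀ θ, ‖circleMap 0 r θ‖ = r := fun r hr θ => by
    rw [norm_circleMap_zero, abs_of_nonneg hr]
  have hg0 : g 0 = H (τ * Complex.I) := by simp [hg, cayley, mul_comm]
  have hle : ∀ r ∈ Ioo (0 : ℝ) 1, ‖g 0‖ ^ q
      ≤ (2 * π)⁻¹ * ∫ θ in Ioo (-π) π, ‖g (circleMap 0 r θ)‖ ^ q := by
    intro r hr
    have h := norm_rpow_le_circleAverage hr.1 hq (hgan r hr.2)
    -- Angles are moved to `(-π, π)`, so that the point `-1`, sent to infinity, is only an endpoint.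
    rw [circleAverage_eq_integral_add (-π), smul_eq_mul,
      intervalIntegral.integral_comp_add_right (fun θ => ‖g (circleMap 0 r θ)‖ ^ q),
      intervalIntegral.integral_of_le (by linarith [pi_pos]), integral_Ioc_eq_integral_Ioo] at h
    rwa [zero_add, show 2 * π + -π = π by ring] at h
  have hlim : Tendsto (fun r : ℝ => (2 * π)⁻¹ * ∫ θ in Ioo (-π) π, ‖g (circleMap 0 r θ)‖ ^ q)
      (𝓝[<] 1) (𝓝 ((2 * π)⁻¹ * ∫ θ in Ioo (-π) π, ‖g (circleMap 0 1 θ)‖ ^ q)) := by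
    have hev : ∀ᶠ r in 𝓝[<] (1 : ℝ), r ∈ Ioo (0 : ℝ) 1 := Ioo_mem_nhdsLT one_pos
    -- Boundedness of `H` supplies the constant majorant, so no limit of `H` at infinity is needed.
    refine Tendsto.const_mul _ (tendsto_integral_filter_of_dominated_convergence (fun _ => M ^ q)
      ?_ ?_ (integrable_const _) ?_)
    · filter_upwards [hev] with r hr
      refine Continuous.aestronglyMeasurable (Continuous.rpow_const ?_ fun _ => Or.inr hq.le)
      refine ((hgan r hr.2).continuousOn.comp_continuous (continuous_circleMap 0 r) fun θ => ?_).norm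
      simp [hnorm r hr.1.le]
    · filter_upwards [hev] with r hr
      refine Eventually.of_forall fun θ => ?_
      rw [norm_of_nonneg (by positivity)]
      exact rpow_le_rpow (norm_nonneg _) (hgb _ (by rw [hnorm r hr.1.le]; exact hr.2.le)) hq.le
    · filter_upwards [ae_restrict_mem measurableSet_Ioo] with θ hθ
      have hw : Tendsto (fun r : ℝ => cayley τ (circleMap 0 r θ)) (𝓝[<] 1)
          (𝓝[{z | 0 ≤ z.im}] (cayley τ (circleMap 0 1 θ))) := by
        refine tendsto_nhdsWithin_iff.2 ⟨?_, ?_⟩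
        · refine (differentiableAt_cayley τ
            (one_add_circleMap_ne_zero hθ)).continuousAt.tendsto.comp ?_
          have : Continuous fun r : ℝ => circleMap 0 r θ := by unfold circleMap; fun_prop
          exact (this.tendsto 1).mono_left nhdsWithin_le_nhds
        · filter_upwards [hev] with r hr
          exact im_cayley_nonneg hτ (by rw [hnorm r hr.1.le]; exact hr.2.le)
      have := (hc _ (im_cayley_nonneg hτ (hnorm 1 zero_le_one θ).le)).tendsto.comp hw
      exact this.norm.rpow_const (Or.inr hq.le)
  have key := ge_of_tendsto hlim (mem_of_superset (Ioo_mem_nhdsLT one_pos) hle)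
  rw [integral_Ioo_eq_integral_linePoissonKernel hτ, hg0] at key
  simpa only [hg, cayley_circleMap_two_arctan hτ.ne'] using key

/-! ### Geometry of the cone and the tube. -/

lemma cpoint_add_smul {n : ℕ} (x y v : EuclideanSpace ℝ (Fin n)) (a b : ℝ) :
    cpoint (x + a • v) (y + b • v) = cpoint x y + ((a : ℂ) + b * Complex.I) • cpoint v 0 := by
  ext k
  simp [cpoint]
  ring

lemma continuous_cpoint {n : ℕ} :
    Continuous fun p : EuclideanSpace ℝ (Fin n) × EuclideanSpace ℝ (Fin n) => cpoint p.1 p.2 := by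
  unfold cpoint
  fun_prop

lemma proj_add {n m : ℕ} (e : Fin m → EuclideanSpace ℝ (Fin n)) (s t : Fin m → ℝ) :
    proj e (s + t) = proj e s + proj e t := by
  simp [proj, add_smul, Finset.sum_add_distrib]

lemma add_proj_mem_cone {n m : ℕ} {e : Fin m → EuclideanSpace ℝ (Fin n)}
    {y : EuclideanSpace ℝ (Fin n)} (hy : y ∈ cone e) {t : Fin m → ℝ} (ht : ∀ j, 0 ≤ t j) :
    y + proj e t ∈ cone e := by
  obtain ⟨s, hs, rfl⟩ := hy
  exact ⟨s + t, fun j => add_pos_of_pos_of_nonneg (hs j) (ht j), (proj_add e s t).symm⟩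

/-- The cone is the image of the open orthant under a surjective, hence open, linear map. -/
lemma isOpen_cone {n m : ℕ} {e : Fin m → EuclideanSpace ℝ (Fin n)}
    (he : Submodule.span ℝ (range e) = ⊤) : IsOpen (cone e) := by
  have hsurj : Function.Surjective (Fintype.linearCombination ℝ e) := by
    rw [← LinearMap.range_eq_top, Fintype.range_linearCombination, he]
  have h := LinearMap.isOpenMap_of_finiteDimensional _ hsurj {t | ∀ j, 0 < t j} (by
    simp only [ofPred_forall]
    exact isOpen_iInter_of_finite fun j => isOpen_lt continuous_const (continuous_apply j))
  convert h using 1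
  ext y
  constructor
  · rintro ⟨t, ht, rfl⟩
    exact ⟨t, ht, rfl⟩
  · rintro ⟨t, ht, rfl⟩
    exact ⟨t, ht, rfl⟩

lemma cpoint_mem_tube {n m : ℕ} {e : Fin m → EuclideanSpace ℝ (Fin n)}
    {x y : EuclideanSpace ℝ (Fin n)} (hy : y ∈ cone e) : cpoint x y ∈ tube e :=
  ⟨x, y, hy, rfl⟩

lemma isOpen_tube {n m : ℕ} {e : Fin m → EuclideanSpace ℝ (Fin n)} (he : IsOpen (cone e)) :
    IsOpen (tube e) := by
  have hc : Continuous fun z : EuclideanSpace ℂ (Fin n) =>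
      (WithLp.toLp 2 fun k => (z k).im : EuclideanSpace ℝ (Fin n)) := by fun_prop
  convert he.preimage hc using 1
  ext z
  constructor
  · rintro ⟨x, y, hy, rfl⟩
    have h : (WithLp.toLp 2 fun k => (cpoint x y k).im : EuclideanSpace ℝ (Fin n)) = y := by
      ext k
      simp [cpoint]
    exact mem_preimage.2 (h.symm ▸ hy)
  · intro hz
    refine ⟨WithLp.toLp 2 fun k => (z k).re, _, hz, ?_⟩
    ext k
    apply Complex.ext <;> simp [cpoint]

/-! ### From circle averages to ball averages. -/

/-- Multiplication by `exp (i θ)` on `V × V`, seen as the complexification of `V`. -/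
noncomputable def rotation (V : Type*) [AddCommGroup V] [Module ℝ V] (θ : ℝ) :
    V × V →ₗ[ℝ] V × V :=
  LinearMap.prod (cos θ • LinearMap.fst ℝ V V - sin θ • LinearMap.snd ℝ V V)
    (sin θ • LinearMap.fst ℝ V V + cos θ • LinearMap.snd ℝ V V)

lemma rotation_apply {V : Type*} [AddCommGroup V] [Module ℝ V] (θ : ℝ) (p : V × V) :
    rotation V θ p = (cos θ • p.1 - sin θ • p.2, sin θ • p.1 + cos θ • p.2) := rfl

lemma rotation_rotation_neg {V : Type*} [AddCommGroup V] [Module ℝ V] (θ : ℝ) (p : V × V) :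
    rotation V θ (rotation V (-θ) p) = p := by
  have h := sin_sq_add_cos_sq θ
  simp only [rotation_apply, cos_neg, sin_neg]
  refine Prod.ext ?_ ?_
  · calc _ = (sin θ ^ 2 + cos θ ^ 2) • p.1 := by module
      _ = p.1 := by rw [h, one_smul]
  · calc _ = (sin θ ^ 2 + cos θ ^ 2) • p.2 := by module
      _ = p.2 := by rw [h, one_smul]

lemma cpoint_add_rotation {n : ℕ} (x y : EuclideanSpace ℝ (Fin n))
    (v : EuclideanSpace ℝ (Fin n) × EuclideanSpace ℝ (Fin n)) (θ : ℝ) :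
    cpoint (x + (rotation _ θ v).1) (y + (rotation _ θ v).2)
      = cpoint x y + circleMap 0 1 θ • cpoint v.1 v.2 := by
  have hre : (circleMap 0 1 θ).re = cos θ := by rw [circleMap_zero_re, one_mul]
  have him : (circleMap 0 1 θ).im = sin θ := by rw [circleMap_zero_im, one_mul]
  ext k
  apply Complex.ext
  · simp [cpoint, rotation_apply, hre, him, -Complex.ofReal_cos, -Complex.ofReal_sin]
  · simp [cpoint, rotation_apply, hre, him, -Complex.ofReal_cos, -Complex.ofReal_sin]
    ring

lemma ofReal_smul_cpoint {n : ℕ} (ρ : ℝ) (x y : EuclideanSpace ℝ (Fin n)) :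
    (ρ : ℂ) • cpoint x y = cpoint (ρ • x) (ρ • y) := by
  ext k
  simp [cpoint]
  ring

lemma continuous_rotation {V : Type*} [NormedAddCommGroup V] [NormedSpace ℝ V] :
    Continuous fun q : (V × V) × ℝ => rotation V q.2 q.1 := by
  simp only [rotation_apply]
  fun_prop

/-- The Euclidean ball of radius `r` about the origin of `V × V`. -/
def prodBall (V : Type*) [NormedAddCommGroup V] (r : ℝ) : Set (V × V) :=
  {p | ‖p.1‖ ^ 2 + ‖p.2‖ ^ 2 < r ^ 2}

lemma isOpen_prodBall (V : Type*) [NormedAddCommGroup V] (r : ℝ) : IsOpen (prodBall V r) :=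
  isOpen_lt (by fun_prop) continuous_const

lemma prodBall_subset {V : Type*} [NormedAddCommGroup V] {r : ℝ} (hr : 0 ≤ r) :
    prodBall V r ⊆ ball 0 r ×ˢ ball 0 r := by
  intro p hp
  have hp' : ‖p.1‖ ^ 2 + ‖p.2‖ ^ 2 < r ^ 2 := hp
  simp only [mem_prod, mem_ball, dist_zero_right]
  exact ⟨lt_of_pow_lt_pow_left₀ 2 hr (by nlinarith [sq_nonneg ‖p.2‖]),
    lt_of_pow_lt_pow_left₀ 2 hr (by nlinarith [sq_nonneg ‖p.1‖])⟩

section Rotation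

variable {V : Type*} [NormedAddCommGroup V] [InnerProductSpace ℝ V]

/-- The cross terms cancel; the sup-norm ball of `V × V` would not be invariant. -/
lemma rotation_mem_prodBall {r θ : ℝ} {p : V × V} (hp : p ∈ prodBall V r) :
    rotation V θ p ∈ prodBall V r := by
  have hp' : ‖p.1‖ ^ 2 + ‖p.2‖ ^ 2 < r ^ 2 := hp
  have h : ‖cos θ • p.1 - sin θ • p.2‖ ^ 2 + ‖sin θ • p.1 + cos θ • p.2‖ ^ 2
      = ‖p.1‖ ^ 2 + ‖p.2‖ ^ 2 := by
    rw [norm_sub_sq_real, norm_add_sq_real]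
    simp only [norm_smul, real_inner_smul_left, real_inner_smul_right, mul_pow, norm_eq_abs,
      sq_abs]
    linear_combination (‖p.1‖ ^ 2 + ‖p.2‖ ^ 2) * sin_sq_add_cos_sq θ
  change ‖cos θ • p.1 - sin θ • p.2‖ ^ 2 + ‖sin θ • p.1 + cos θ • p.2‖ ^ 2 < r ^ 2
  rwa [h]

lemma image_rotation_prodBall (r θ : ℝ) : rotation V θ '' prodBall V r = prodBall V r := by
  refine Subset.antisymm (image_subset_iff.2 fun p hp => rotation_mem_prodBall hp) fun p hp => ?_
  exact ⟨rotation V (-θ) p, rotation_mem_prodBall hp, rotation_rotation_neg θ p⟩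

lemma preimage_rotation_prodBall (r θ : ℝ) : rotation V θ ⁻¹' prodBall V r = prodBall V r := by
  refine Subset.antisymm (fun p hp => ?_) fun p hp => rotation_mem_prodBall hp
  have := rotation_mem_prodBall (θ := -θ) hp
  have h := rotation_rotation_neg (-θ) p
  rw [neg_neg] at h
  rwa [h] at this

variable [FiniteDimensional ℝ V] [MeasurableSpace V] [BorelSpace V]

lemma measure_prodBall_pos {r : ℝ} (hr : 0 < r) : 0 < volume (prodBall V r) :=
  have : (volume : Measure (V × V)).IsAddHaarMeasure :=
    inferInstanceAs ((volume : Measure V).prod volume).IsAddHaarMeasure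
  (isOpen_prodBall V r).measure_pos _ ⟨0, by simp [prodBall, hr]⟩

lemma measure_prodBall_lt_top {r : ℝ} (hr : 0 ≤ r) : volume (prodBall V r) < ∞ :=
  (measure_mono (prodBall_subset hr)).trans_lt
    (isBounded_ball.prod isBounded_ball).measure_lt_top

/-- A set of finite positive measure is mapped onto itself, which forces `|det| = 1`. -/
lemma measurePreserving_rotation (θ : ℝ) : MeasurePreserving (rotation V θ) := by
  have : (volume : Measure (V × V)).IsAddHaarMeasure :=
    inferInstanceAs ((volume : Measure V).prod volume).IsAddHaarMeasure
  have h := Measure.addHaar_image_linearMap (volume : Measure (V × V)) (rotation V θ)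
    (prodBall V 1)
  rw [image_rotation_prodBall] at h
  have h1 : ENNReal.ofReal |LinearMap.det (rotation V θ)| = 1 := by
    have hne := (measure_prodBall_pos (V := V) one_pos).ne'
    have htop := (measure_prodBall_lt_top (V := V) zero_le_one).ne
    exact (ENNReal.mul_left_inj hne htop).1 (by rw [one_mul]; exact h.symm)
  have h2 : |LinearMap.det (rotation V θ)| = 1 := by simpa using h1
  have h3 : LinearMap.det (rotation V θ) ≠ 0 := by
    intro h0; rw [h0] at h2; simp at h2
  refine ⟨(rotation V θ).continuous_of_finiteDimensional.measurable, ?_⟩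
  rw [Measure.map_linearMap_addHaar_eq_smul_addHaar _ h3, abs_inv, h2]
  simp

/-- A sub-mean value property over circles gives one over balls. -/
lemma mul_measure_prodBall_le_lintegral {h : V × V → ℝ≥0∞} (hh : Measurable h) {p : V × V}
    {r : ℝ} (hsub : ∀ v ∈ prodBall V r, h p ≤
      ENNReal.ofReal (2 * π)⁻¹ * ∫⁻ θ in Ioc 0 (2 * π), h (p + rotation V θ v)) :
    h p * volume (prodBall V r) ≤ ∫⁻ v in prodBall V r, h (p + v) := by
  have hmB := (isOpen_prodBall V r).measurableSet
  have hjoint : Measurable fun q : (V × V) × ℝ => h (p + rotation V q.2 q.1) :=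
    hh.comp (continuous_const.add continuous_rotation).measurable
  calc h p * volume (prodBall V r) = ∫⁻ _ in prodBall V r, h p := by rw [setLIntegral_const]
    _ ≤ ∫⁻ v in prodBall V r,
        ENNReal.ofReal (2 * π)⁻¹ * ∫⁻ θ in Ioc 0 (2 * π), h (p + rotation V θ v) :=
      setLIntegral_mono' hmB hsub
    _ = ENNReal.ofReal (2 * π)⁻¹ *
        ∫⁻ θ in Ioc 0 (2 * π), ∫⁻ v in prodBall V r, h (p + rotation V θ v) := by
      rw [lintegral_const_mul' _ _ ENNReal.ofReal_ne_top, lintegral_lintegral_swap]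
      exact hjoint.aemeasurable
    _ = ENNReal.ofReal (2 * π)⁻¹ *
        ∫⁻ _ in Ioc 0 (2 * π), ∫⁻ v in prodBall V r, h (p + v) := by
      congr 1
      refine lintegral_congr fun θ => ?_
      have := (measurePreserving_rotation (V := V) θ).setLIntegral_comp_preimage hmB
        (hh.comp (measurable_const_add p))
      rw [preimage_rotation_prodBall] at this
      exact this
    _ = _ := by
      rw [setLIntegral_const, Real.volume_Ioc, mul_comm, mul_assoc, sub_zero,
        ← ENNReal.ofReal_mul (by positivity), mul_inv_cancel₀ (by positivity)]
      simp

/-- Enlarging the ball to `univ ×ˢ ball 0 r` leaves full slices in the first variable, the integrals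
that the `H^1` norm controls. -/
lemma lintegral_prodBall_le {h : V × V → ℝ≥0∞} (hh : Measurable h) {x y : V} {r : ℝ}
    (hr : 0 ≤ r) {A : ℝ≥0∞} (hA : ∀ b ∈ ball (0 : V) r, ∫⁻ a, h (a, y + b) ≤ A) :
    ∫⁻ v in prodBall V r, h ((x, y) + v) ≤ A * volume (ball (0 : V) r) := by
  have hsub : prodBall V r ⊆ univ ×ˢ ball 0 r :=
    (prodBall_subset hr).trans (prod_mono_left (subset_univ _))
  calc ∫⁻ v in prodBall V r, h ((x, y) + v)
      ≤ ∫⁻ v in univ ×ˢ ball 0 r, h ((x, y) + v) := lintegral_mono_set hsub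
    _ = ∫⁻ b in ball (0 : V) r, ∫⁻ a, h (x + a, y + b) := by
      rw [Measure.volume_eq_prod, ← Measure.prod_restrict, lintegral_prod_symm',
        Measure.restrict_univ]
      · rfl
      · exact hh.comp (measurable_const_add _)
    _ ≤ ∫⁻ _ in ball (0 : V) r, A := by
      refine setLIntegral_mono' measurableSet_ball fun b hb => ?_
      rw [lintegral_add_left_eq_self (fun a => h (a, y + b)) x]
      exact hA b hb
    _ = _ := by rw [setLIntegral_const]

end Rotation

/-! ### Boundedness of `H^1` functions inside the tube. -/

/-- The circular mean value inequality along the complex disc `z + ζ w`, `‖ζ‖ ≤ 1`. -/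
lemma enorm_le_lintegral_circle {n : ℕ} {F : EuclideanSpace ℂ (Fin n) → ℂ}
    {W : Set (EuclideanSpace ℂ (Fin n))} (hW : IsOpen W) (hF : DifferentiableOn ℂ F W)
    {z w : EuclideanSpace ℂ (Fin n)} (hzw : ∀ ζ : ℂ, ‖ζ‖ ≤ 1 → z + ζ • w ∈ W) :
    ‖F z‖ₑ ≤ ENNReal.ofReal (2 * π)⁻¹ *
      ∫⁻ θ in Ioc 0 (2 * π), ‖F (z + circleMap 0 1 θ • w)‖ₑ := by
  have hd : DiffContOnCl ℂ (fun ζ : ℂ => F (z + ζ • w)) (ball 0 |1|) := by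
    refine DifferentiableOn.diffContOnCl fun ζ hζ => ?_
    rw [abs_one, closure_ball _ one_ne_zero] at hζ
    refine ((hF.differentiableAt (hW.mem_nhds (hzw ζ (by simpa using hζ)))).comp ζ
      (f := fun ζ : ℂ => z + ζ • w) (by fun_prop)).differentiableWithinAt
  have h := hd.circleAverage
  rw [circleAverage_def, zero_smul, add_zero, intervalIntegral.integral_of_le (by positivity)] at h
  rw [← h, enorm_smul, Real.enorm_of_nonneg (by positivity)]
  gcongr
  exact enorm_integral_le_lintegral_enorm _

/-- Functions in `H^1` are bounded on the translates of the tube into itself. -/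
lemma MemHardy.exists_bound {n m : ℕ} {e : Fin m → EuclideanSpace ℝ (Fin n)}
    {F : EuclideanSpace ℂ (Fin n) → ℂ} (hF : MemHardy e 1 F) (ho : IsOpen (cone e))
    {y₀ : EuclideanSpace ℝ (Fin n)} (hy₀ : y₀ ∈ cone e) :
    ∃ M : ℝ, ∀ x, ∀ t : Fin m → ℝ, (∀ j, 0 ≤ t j) → ‖F (cpoint x (y₀ + proj e t))‖ ≤ M := by
  obtain ⟨hd, hfin⟩ := hF
  set A : ℝ≥0∞ := ⨆ y ∈ cone e, ∫⁻ x : EuclideanSpace ℝ (Fin n), ‖F (cpoint x y)‖ₑ with hA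
  have hAtop : A < ∞ := by simpa [hardyNorm] using hfin
  set s : Set (EuclideanSpace ℝ (Fin n) × EuclideanSpace ℝ (Fin n)) := {p | p.2 ∈ cone e} with hs
  have hso : IsOpen s := ho.preimage continuous_snd
  -- Extension by zero off the tube gives a function measurable on the whole product.
  set h : EuclideanSpace ℝ (Fin n) × EuclideanSpace ℝ (Fin n) → ℝ≥0∞ :=
    s.indicator fun p => ‖F (cpoint p.1 p.2)‖ₑ with hh
  have hhm : Measurable h := by
    classical
    rw [hh, ← piecewise_eq_indicator]
    refine ContinuousOn.measurable_piecewise ?_ continuousOn_const hso.measurableSet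
    exact (hd.continuousOn.comp continuous_cpoint.continuousOn
      fun p hp => cpoint_mem_tube hp).enorm
  have hhe : ∀ x, ∀ y ∈ cone e, h (x, y) = ‖F (cpoint x y)‖ₑ := fun x y hy =>
    indicator_of_mem (s := s) hy _
  -- The radius at `y₀` serves every `y₀ + proj e t`, since the cone absorbs `proj e t`; hence the
  -- bound is uniform in `x` and `t`.
  obtain ⟨r, hr, hball⟩ := Metric.isOpen_iff.1 ho y₀ hy₀
  set B := volume (prodBall (EuclideanSpace ℝ (Fin n)) r)
  have hB0 : B ≠ 0 := (measure_prodBall_pos hr).ne'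
  have hBtop : B ≠ ∞ := (measure_prodBall_lt_top hr.le).ne
  set N := A * volume (ball (0 : EuclideanSpace ℝ (Fin n)) r) / B
  have hN : N ≠ ∞ := ENNReal.div_ne_top (ENNReal.mul_ne_top hAtop.ne measure_ball_lt_top.ne) hB0
  refine ⟨N.toReal, fun x t ht => ?_⟩
  have hcone : ∀ b : EuclideanSpace ℝ (Fin n), ‖b‖ < r → y₀ + proj e t + b ∈ cone e := by
    intro b hb
    rw [add_right_comm]
    exact add_proj_mem_cone (hball (by simpa using hb)) ht
  have hy : y₀ + proj e t ∈ cone e := add_proj_mem_cone hy₀ ht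
  have h1 : h (x, y₀ + proj e t) * B ≤
      ∫⁻ v in prodBall (EuclideanSpace ℝ (Fin n)) r, h ((x, y₀ + proj e t) + v) := by
    refine mul_measure_prodBall_le_lintegral hhm fun v hv => ?_
    rw [hhe _ _ hy]
    have hrot : ∀ θ, ‖(rotation (EuclideanSpace ℝ (Fin n)) θ v).2‖ < r := fun θ => by
      simpa using (prodBall_subset hr.le (rotation_mem_prodBall (θ := θ) hv)).2
    refine (enorm_le_lintegral_circle (w := cpoint v.1 v.2) (isOpen_tube ho) hd ?_).trans_eq ?_
    · intro ζ hζ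
      have hv' : ((‖ζ‖ : ℝ) • v.1, (‖ζ‖ : ℝ) • v.2) ∈
          prodBall (EuclideanSpace ℝ (Fin n)) r := by
        have hv2 : ‖v.1‖ ^ 2 + ‖v.2‖ ^ 2 < r ^ 2 := hv
        have hζ2 : ‖ζ‖ ^ 2 ≤ 1 := pow_le_one₀ (norm_nonneg _) hζ
        simp only [prodBall, mem_ofPred_eq, norm_smul, norm_norm, mul_pow, ← mul_add]
        nlinarith [sq_nonneg ‖v.1‖, sq_nonneg ‖v.2‖]
      -- Polar form: the modulus shrinks `v` inside the ball, the argument rotates it.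
      have hζc : ζ • cpoint v.1 v.2
          = circleMap 0 1 ζ.arg • cpoint ((‖ζ‖ : ℝ) • v.1) ((‖ζ‖ : ℝ) • v.2) := by
        rw [← ofReal_smul_cpoint, smul_smul]
        congr 1
        rw [circleMap_zero, Complex.ofReal_one, one_mul, mul_comm, Complex.norm_mul_exp_arg_mul_I]
      have := cpoint_add_rotation x (y₀ + proj e t) ((‖ζ‖ : ℝ) • v.1, (‖ζ‖ : ℝ) • v.2) ζ.arg
      rw [hζc, ← this]
      refine cpoint_mem_tube (hcone _ ?_)
      simpa using (prodBall_subset hr.le (rotation_mem_prodBall (θ := ζ.arg) hv')).2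
    · congr 1
      refine lintegral_congr fun θ => ?_
      rw [← cpoint_add_rotation]
      exact (hhe _ _ (hcone _ (hrot θ))).symm
  have h2 := h1.trans (lintegral_prodBall_le hhm hr.le (A := A) fun b hb => ?_)
  · rw [hhe _ _ hy, ← ENNReal.le_div_iff_mul_le (Or.inl hB0) (Or.inl hBtop)] at h2
    rw [← toReal_enorm]
    exact ENNReal.toReal_mono hN h2
  · have hb' := hcone b (by simpa using hb)
    simp only [hhe _ _ hb']
    exact le_iSup₂ (f := fun y (_ : y ∈ cone e) => ∫⁻ x, ‖F (cpoint x y)‖ₑ) _ hb'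

/-! ### Poisson integrals along lines and their iteration. -/

lemma linePoissonKernel_nonneg {t : ℝ} (ht : 0 ≤ t) (s : ℝ) : 0 ≤ linePoissonKernel t s := by
  unfold linePoissonKernel
  positivity

lemma linePoissonKernel_neg (t s : ℝ) : linePoissonKernel t (-s) = linePoissonKernel t s := by
  simp [linePoissonKernel]

lemma integrable_linePoissonKernel {t : ℝ} (ht : 0 < t) : Integrable (linePoissonKernel t) := by
  have h := (integrable_inv_one_add_sq.comp_div ht.ne').const_mul (1 / (π * t))
  refine h.congr (Eventually.of_forall fun s => ?_)
  have : 0 < t ^ 2 + s ^ 2 := by positivity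
  simp only [linePoissonKernel]
  field_simp

section

variable {n : ℕ}

lemma integrable_mul_linePoissonKernel {g : EuclideanSpace ℝ (Fin n) → ℝ} (hg : Continuous g)
    {C : ℝ} (hC : ∀ x, |g x| ≤ C) {t : ℝ} (ht : 0 < t) (v x : EuclideanSpace ℝ (Fin n)) :
    Integrable fun s : ℝ => g (x - s • v) * linePoissonKernel t s :=
  (integrable_linePoissonKernel ht).bdd_mul (c := C)
    (by fun_prop : Continuous fun s : ℝ => g (x - s • v)).aestronglyMeasurable
    (Eventually.of_forall fun _ => hC _)

lemma continuous_lineConv {g : EuclideanSpace ℝ (Fin n) → ℝ} (hg : Continuous g)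
    {C : ℝ} (hC : ∀ x, |g x| ≤ C) {t : ℝ} (ht : 0 < t) (v : EuclideanSpace ℝ (Fin n)) :
    Continuous (lineConv v g (linePoissonKernel t)) := by
  refine continuous_of_dominated (bound := fun s => C * linePoissonKernel t s)
    (fun x => (integrable_mul_linePoissonKernel hg hC ht v x).aestronglyMeasurable)
    (fun x => Eventually.of_forall fun s => ?_) ((integrable_linePoissonKernel ht).const_mul C)
    (Eventually.of_forall fun s => by fun_prop)
  rw [norm_mul, norm_of_nonneg (linePoissonKernel_nonneg ht.le s)]
  exact mul_le_mul_of_nonneg_right (hC _) (linePoissonKernel_nonneg ht.le s)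

lemma abs_lineConv_le {g : EuclideanSpace ℝ (Fin n) → ℝ}
    {C : ℝ} (hC : ∀ x, |g x| ≤ C) {t : ℝ} (ht : 0 < t) (v x : EuclideanSpace ℝ (Fin n)) :
    |lineConv v g (linePoissonKernel t) x| ≤ ∫ s, C * linePoissonKernel t s := by
  rw [← norm_eq_abs]
  refine norm_integral_le_of_norm_le ((integrable_linePoissonKernel ht).const_mul C)
    (Eventually.of_forall fun s => ?_)
  rw [norm_mul, norm_of_nonneg (linePoissonKernel_nonneg ht.le s)]
  exact mul_le_mul_of_nonneg_right (hC _) (linePoissonKernel_nonneg ht.le s)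

/-- Continuity and boundedness survive each convolution, which is what makes the next integral
converge. -/
lemma continuous_iteratedPoisson {g : EuclideanSpace ℝ (Fin n) → ℝ} (hg : Continuous g)
    {C : ℝ} (hC : ∀ x, |g x| ≤ C) (m : ℕ) (e : Fin m → EuclideanSpace ℝ (Fin n)) (t : Fin m → ℝ)
    (ht : ∀ j, 0 < t j) :
    Continuous (iteratedPoisson g m e t) ∧ ∃ C', ∀ x, |iteratedPoisson g m e t x| ≤ C' := by
  induction m with
  | zero => exact ⟨hg, C, hC⟩
  | succ m ih =>
    obtain ⟨h1, C', h2⟩ := ih (fun j => e j.castSucc) (fun j => t j.castSucc) fun j => ht _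
    exact ⟨continuous_lineConv h1 h2 (ht _) _, _, abs_lineConv_le h2 (ht _) _⟩

lemma iteratedPoissonConverges_of_bounded {g : EuclideanSpace ℝ (Fin n) → ℝ} (hg : Continuous g)
    {C : ℝ} (hC : ∀ x, |g x| ≤ C) (m : ℕ) (e : Fin m → EuclideanSpace ℝ (Fin n)) (t : Fin m → ℝ)
    (ht : ∀ j, 0 < t j) : IteratedPoissonConverges g m e t := by
  induction m with
  | zero => trivial
  | succ m ih =>
    obtain ⟨h1, C', h2⟩ := continuous_iteratedPoisson hg hC m (fun j => e j.castSucc)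
      (fun j => t j.castSucc) fun j => ht _
    exact ⟨ih _ _ fun j => ht _, integrable_mul_linePoissonKernel h1 h2 (ht _) _⟩

/-- The Poisson majorization in one direction `v`. -/
lemma norm_rpow_le_lineConv {F : EuclideanSpace ℂ (Fin n) → ℂ} {W : Set (EuclideanSpace ℂ (Fin n))}
    (hF : DifferentiableOn ℂ F W) {v y : EuclideanSpace ℝ (Fin n)} {M q τ : ℝ}
    (hq : 0 < q) (hτ : 0 < τ) (hyW : ∀ x, ∀ σ : ℝ, 0 ≤ σ → cpoint x (y + σ • v) ∈ W)
    (hM : ∀ x, ∀ σ : ℝ, 0 ≤ σ → ‖F (cpoint x (y + σ • v))‖ ≤ M) (x : EuclideanSpace ℝ (Fin n)) :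
    ‖F (cpoint x (y + τ • v))‖ ^ q
      ≤ lineConv v (fun x => ‖F (cpoint x y)‖ ^ q) (linePoissonKernel τ) x := by
  have hline : ∀ z : ℂ, cpoint x y + z • cpoint v 0 = cpoint (x + z.re • v) (y + z.im • v) :=
    fun z => by rw [cpoint_add_smul, Complex.re_add_im]
  have hd : DifferentiableOn ℂ (fun z : ℂ => F (cpoint x y + z • cpoint v 0)) {z | 0 ≤ z.im} := by
    refine hF.comp (by fun_prop) fun z hz => ?_
    rw [hline]
    exact hyW _ _ hz
  have h := norm_rpow_le_integral_linePoissonKernel hq hτ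
    (hd.mono fun z (hz : 0 < z.im) => hz.le) hd.continuousOn
    (fun z hz => by rw [hline]; exact hM _ _ hz)
  simp only [hline] at h
  simp only [Complex.mul_re, Complex.mul_im, Complex.ofReal_re, Complex.ofReal_im, Complex.I_re,
    Complex.I_im, mul_zero, mul_one, sub_self, zero_smul, add_zero] at h
  refine h.trans_eq ?_
  -- The boundary integral uses `x + s • v`, the convolution `x - s • v`; the kernel is even.
  rw [lineConv, ← integral_neg_eq_self]
  simp only [linePoissonKernel_neg, neg_smul, ← sub_eq_add_neg]

/-- The Poisson majorization in several directions, for functions that are bounded on a tube whose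
base is stable under the nonnegative multiples of these directions. -/
lemma norm_rpow_le_iteratedPoisson {F : EuclideanSpace ℂ (Fin n) → ℂ}
    {W : Set (EuclideanSpace ℂ (Fin n))} (hF : DifferentiableOn ℂ F W)
    {S : Set (EuclideanSpace ℝ (Fin n))} {M q : ℝ} (hq : 0 < q)
    (hSW : ∀ x, ∀ y ∈ S, cpoint x y ∈ W) (hM : ∀ x, ∀ y ∈ S, ‖F (cpoint x y)‖ ≤ M)
    {y₀ : EuclideanSpace ℝ (Fin n)} (hy₀ : y₀ ∈ S) (m : ℕ)
    (e : Fin m → EuclideanSpace ℝ (Fin n)) (t : Fin m → ℝ) (ht : ∀ j, 0 < t j)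
    (hS : ∀ y ∈ S, ∀ j, ∀ σ : ℝ, 0 ≤ σ → y + σ • e j ∈ S) :
    y₀ + proj e t ∈ S ∧
    IteratedPoissonConverges (fun x => ‖F (cpoint x y₀)‖ ^ q) m e t ∧
    ∀ x, ‖F (cpoint x (y₀ + proj e t))‖ ^ q
      ≤ iteratedPoisson (fun x => ‖F (cpoint x y₀)‖ ^ q) m e t x := by
  have hcont : ∀ y ∈ S, Continuous fun x => ‖F (cpoint x y)‖ ^ q := fun y hy => by
    refine Continuous.rpow_const (Continuous.norm ?_) fun _ => Or.inr hq.le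
    exact hF.continuousOn.comp_continuous
      (continuous_cpoint.comp (Continuous.prodMk_left y)) fun x => hSW x y hy
  have hbd : ∀ y ∈ S, ∀ x, |‖F (cpoint x y)‖ ^ q| ≤ M ^ q := fun y hy x => by
    rw [abs_of_nonneg (by positivity)]
    exact rpow_le_rpow (norm_nonneg _) (hM x y hy) hq.le
  induction m with
  | zero => simpa [proj, IteratedPoissonConverges, iteratedPoisson] using hy₀
  | succ m ih =>
    obtain ⟨hy₁, -, hle⟩ := ih (fun j => e j.castSucc) (fun j => t j.castSucc) (fun j => ht _)
      fun y hy j => hS y hy _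
    have hproj : y₀ + proj e t = y₀ + proj (fun j => e j.castSucc) (fun j => t j.castSucc)
        + t (Fin.last m) • e (Fin.last m) := by
      rw [add_assoc]
      congr 1
      exact Fin.sum_univ_castSucc _
    set y₁ := y₀ + proj (fun j => e j.castSucc) (fun j => t j.castSucc)
    have hconv := iteratedPoissonConverges_of_bounded (hcont y₀ hy₀) (hbd y₀ hy₀) _ e t ht
    refine ⟨hproj ▸ hS _ hy₁ _ _ (ht _).le, hconv, fun x => ?_⟩
    rw [hproj]
    -- The last, outermost convolution starts from boundary data at height `y₁`; the induction
    -- hypothesis then bounds these data under the integral.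
    refine (norm_rpow_le_lineConv hF hq (ht _) (fun x σ hσ => hSW _ _ (hS _ hy₁ _ _ hσ))
      (fun x σ hσ => hM _ _ (hS _ hy₁ _ _ hσ)) x).trans ?_
    refine integral_mono (integrable_mul_linePoissonKernel (hcont _ hy₁) (hbd _ hy₁) (ht _) _ _)
      (hconv.2 x) fun s => ?_
    exact mul_le_mul_of_nonneg_right (hle _) (linePoissonKernel_nonneg (ht _).le s)

end

lemma span_range_eq_top_of_linearIndependent_subset {K V ι : Type*} [DivisionRing K]
    [AddCommGroup V] [Module K V] [FiniteDimensional K V] [Fintype ι] {e : ι → V}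
    (hcard : Module.finrank K V ≤ Fintype.card ι)
    (he : ∀ S : Finset ι, S.card = Module.finrank K V → LinearIndependent K fun j : S => e j) :
    Submodule.span K (range e) = ⊤ := by
  obtain ⟨S, -, hS⟩ := Finset.exists_subset_card_eq (s := (Finset.univ : Finset ι)) hcard
  rw [eq_top_iff, ← (he S hS).span_eq_top_of_card_eq_finrank' (by simpa using hS)]
  exact Submodule.span_mono (range_comp_subset_range Subtype.val e)

end TubeHardy

theorem mainTheorem9 {n m : ℕ} (hnm : n ≤ m)
    (e : Fin m → EuclideanSpace ℝ (Fin n))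
    (he_unit : ∀ j, ‖e j‖ = 1)
    (he_indep : ∀ S : Finset (Fin m), S.card = n → LinearIndependent ℝ (fun j : S => e j))
    (F : EuclideanSpace ℂ (Fin n) → ℂ) (hF : TubeHardy.MemHardy e 1 F)
    (q : ℝ) (hq : 0 < q) (ε : ℝ) (hε : 0 < ε)
    (f : EuclideanSpace ℝ (Fin n) → ℂ)
    (hf : f = fun x => F (TubeHardy.cpoint x (TubeHardy.proj e (fun _ => ε))))
    (t : Fin m → ℝ) (ht : ∀ j, 0 < t j) :
    TubeHardy.IteratedPoissonConverges (fun x => ‖f x‖ ^ q) m e t ∧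
    ∀ x : EuclideanSpace ℝ (Fin n),
      ‖F (TubeHardy.cpoint x (TubeHardy.proj e (fun j => t j + ε)))‖ ^ q ≤
        TubeHardy.iteratedPoisson (fun x => ‖f x‖ ^ q) m e t x := by
  subst hf
  have ho := TubeHardy.isOpen_cone (TubeHardy.span_range_eq_top_of_linearIndependent_subset
    (K := ℝ) (e := e) (by simpa using hnm) (by simpa using he_indep))
  have hy₀ : TubeHardy.proj e (fun _ => ε) ∈ TubeHardy.cone e := ⟨_, fun _ => hε, rfl⟩
  obtain ⟨M, hM⟩ := hF.exists_bound ho hy₀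
  have h := TubeHardy.norm_rpow_le_iteratedPoisson hF.1
    -- This is `y₀` plus the closed cone: it contains `y₀`, lies in the open cone, and carries the
    -- uniform bound `M`.
    (S := {y | ∃ s : Fin m → ℝ, (∀ j, 0 ≤ s j) ∧
      y = TubeHardy.proj e (fun _ => ε) + TubeHardy.proj e s})
    (y₀ := TubeHardy.proj e fun _ => ε) hq
    (by rintro x _ ⟨s, hs, rfl⟩
        exact TubeHardy.cpoint_mem_tube (TubeHardy.add_proj_mem_cone hy₀ hs))
    (by rintro x _ ⟨s, hs, rfl⟩
        exact hM x s hs)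
    ⟨0, fun _ => le_rfl, by simp [TubeHardy.proj]⟩ m e t ht (by
      rintro _ ⟨s, hs, rfl⟩ j σ hσ
      refine ⟨s + Pi.single j σ, fun k => add_nonneg (hs k) ?_, ?_⟩
      · by_cases hk : k = j
        · subst hk; simpa using hσ
        · simp [hk]
      · rw [TubeHardy.proj_add, ← add_assoc]
        congr 1
        simp [TubeHardy.proj, Pi.single_apply])
  refine ⟨h.2.1, fun x => ?_⟩
  convert h.2.2 x using 5
  rw [← TubeHardy.proj_add]
  congr 1
  ext j
  simp [add_comm]
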